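/- Let $d$ be an odd prime, $\omega = e^{2\pi i/d}$, and let $\mathcal{U}$ be the group of unitary operators on $\mathbb{C}^d$, with computational basis $|z\rangle$, $z\in\mathbb{Z}_d=\mathbb{Z}/d\mathbb{Z}$. Let $Z|z\rangle=\omega^z|z\rangle$ and $X|z\rangle=|z+1\rangle$. The single-qudit Clifford hierarchy is defined by $$\mathcal{C}_1=\{\omega^cZ^pX^q : c,p,q\in\mathbb{Z}_d\},\qquad \mathcal{C}_k=\{G\in\mathcal{U} : G\,\mathcal{C}_1G^*\subseteq\mathcal{C}_{k-1}\}\quad(k\ge 2);$$ the elements of $\mathcal{C}_1$ are the Pauli gates and those of $\mathcal{C}_2$ the Clifford gates. For $k\ge1$ let $$\mathcal{D}_k=\{D\in\mathcal{C}_k : D\text{ is diagonal in the computational basis and }D|0\rangle=|0\rangle\}.$$ Theorem. For every odd prime $d$, every gate at every level of the single-qudit Clifford hierarchy is semi-Clifford: for every $k\ge1$ and every $G\in\mathcal{C}_k$ there are Clifford gates $C_1,C_2\in\mathcal{C}_2$ and a diagonal gate $D\in\mathcal{D}_k$ such that $G=C_1DC_2$. -/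

import Mathlib

namespace Qudit

noncomputable section

/-- Unitary gates of one qudit: unitary matrices on `ℂ^d`, with the computational basis
indexed by `ℤ/d`. -/
abbrev Gate (d : ℕ) [NeZero d] : Type := Matrix.unitaryGroup (ZMod d) ℂ

/-- The primitive root of unity `ω = exp(2πi/d)`. -/
def omega (d : ℕ) : ℂ := Complex.exp (2 * Real.pi * Complex.I / d)

/-- The computational basis vector `|z⟩`. -/
def ket {d : ℕ} (z : ZMod d) : ZMod d → ℂ := Pi.single z 1

/-- The matrix `Z`, with `Z|z⟩ = ω^z |z⟩`. -/
def matZ (d : ℕ) : Matrix (ZMod d) (ZMod d) ℂ :=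
  Matrix.diagonal fun z => omega d ^ z.val

/-- The matrix `X`, with `X|z⟩ = |z+1⟩`. -/
def matX (d : ℕ) : Matrix (ZMod d) (ZMod d) ℂ :=
  Matrix.of fun i j => if i = j + 1 then 1 else 0

/-- The Pauli gates: the unitaries `ω^c Z^p X^q` with `c, p, q ∈ ℤ/d`. -/
def pauli (d : ℕ) [NeZero d] : Set (Gate d) :=
  {G | ∃ c p q : ZMod d,
    (G : Matrix (ZMod d) (ZMod d) ℂ) =
      omega d ^ c.val • (matZ d ^ p.val * matX d ^ q.val)}

/-- The levels `𝒞_k` of the Clifford hierarchy, for `k ≥ 1`: the first level is the set of Pauli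
gates, and `𝒞_k = {G | G 𝒞_1 G* ⊆ 𝒞_{k-1}}` for `k ≥ 2`. There is no level `0`; it is given the
value `∅`. -/
def level (d : ℕ) [NeZero d] : ℕ → Set (Gate d)
  | 0 => ∅
  | 1 => pauli d
  | k + 2 => {G | ∀ P ∈ pauli d, G * P * star G ∈ level d (k + 1)}

/-- The Clifford gates: unitaries `C` with `C 𝒞_1 C* ⊆ 𝒞_1`. -/
def clifford (d : ℕ) [NeZero d] : Set (Gate d) :=
  {C | ∀ P ∈ pauli d, C * P * star C ∈ pauli d}

/-- The phaseless diagonal `k`-th level gates `𝒟_k`: the diagonal gates `D` in `𝒞_k`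
with `D|0⟩ = |0⟩`. -/
def diagLevel (d : ℕ) [NeZero d] (k : ℕ) : Set (Gate d) :=
  {D | D ∈ level d k ∧ (D : Matrix (ZMod d) (ZMod d) ℂ).IsDiag ∧
    (D : Matrix (ZMod d) (ZMod d) ℂ).mulVec (ket 0) = ket 0}

/-- The `k`-th level semi-Clifford gates: the gates `G` in `𝒞_k` of the form `G = C₁ D C₂` with
`C₁, C₂` Clifford and `D ∈ 𝒟_k`. -/
def semiClifford (d : ℕ) [NeZero d] (k : ℕ) : Set (Gate d) :=
  {G | G ∈ level d k ∧ ∃ C₁ ∈ clifford d, ∃ D ∈ diagLevel d k, ∃ C₂ ∈ clifford d,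
    G = C₁ * D * C₂}

end

end Qudit

/-!
Call a gate *semi-Clifford* if it conjugates some nonscalar Pauli gate to a Pauli gate. The Clifford
gates act transitively on nonscalar Pauli gates (`exists_clifford_conj_Z_eq`, from the
Stone–von Neumann theorem `exists_conj_Z_X`), so such a gate is, up to Clifford gates on both sides,
a gate commuting with `Z`, that is, a diagonal gate. Levels `k ≥ 2` of the hierarchy are stable under
Clifford multiplication on both sides (`clifford_mul_level_mul`), so the diagonal factor stays in
the level of `G`. It remains to show that every gate in the hierarchy is semi-Clifford in this sense.

This goes by induction on the level, with the Pauli group `P` entering only through the properties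
collected in `IsPauliLike`. Let `G` be such that all gates of the group `K = G P G⁻¹` are
semi-Clifford. The crucial fact is `commute_of_sendsNoncentral_mul`: if `A`, `B` and `A B` are
semi-Clifford and neither `A` nor `B` is Clifford, then the Pauli line that `B` maps to is the Pauli
line that `A` maps from. Applied to `A A`, `A B` and `B B`, with `A`, `B` in `K` not Clifford, it
shows that all gates in `K` that are not Clifford preserve one common line of Pauli gates; if
there are any, they generate `K`, so `K` preserves this line. If instead all gates in `K` are
Clifford, then `K` preserves the whole of `P`. In both cases the `p`-group `K` acts on a nontrivial
`p`-group of Pauli gates modulo phases, so it fixes some nonscalar Pauli gate `y` up to phases.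
Then `G⁻¹ y G` commutes with all Pauli gates up to phases, so it is itself a Pauli gate, and `G` maps
it to `y` (`sendsNoncentral_of_conj`).
-/

namespace Qudit

open Subgroup

/-! ### Groups with the commutation structure of the Pauli group -/

section Heisenberg

variable {Γ : Type*} [Group Γ]

/-- Commutation modulo the centre; for unitary gates, commutation up to a global phase. -/
def PhaseCommute (a b : Γ) : Prop :=
  Commute (a : Γ ⧸ center Γ) (b : Γ ⧸ center Γ)

/-- The properties of the Pauli group, as a subgroup of the group of all gates, from which
semi-Cliffordness is derived: it is a finite group of order at most `p ^ 3` and exponent `p`,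
commutative up to phases; it acts irreducibly (its centralizer is central), and every element of
order dividing `p` that commutes with it up to phases already belongs to it. -/
structure IsPauliLike (p : ℕ) (P : Subgroup Γ) : Prop where
  finite : Finite P
  card_le : Nat.card P ≤ p ^ 3
  pow_eq_one : ∀ x ∈ P, x ^ p = 1
  phaseCommute : ∀ x ∈ P, ∀ y ∈ P, PhaseCommute x y
  mem_center : ∀ g, (∀ x ∈ P, Commute g x) → g ∈ center Γ
  mem_of_phaseCommute : ∀ g, g ^ p = 1 → (∀ x ∈ P, PhaseCommute g x) → g ∈ P

/-- `A` conjugates some noncentral element of `P` into `P`. For the Pauli group of one qudit of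
prime dimension this says that the gate `A` is semi-Clifford. -/
def SendsNoncentral (P : Subgroup Γ) (A : Γ) : Prop :=
  ∃ R ∈ P, R ∉ center Γ ∧ A * R * A⁻¹ ∈ P

theorem PhaseCommute.conj {a b : Γ} (h : PhaseCommute a b) (g : Γ) :
    PhaseCommute (g * a * g⁻¹) (g * b * g⁻¹) := by
  simpa [PhaseCommute] using h

theorem PhaseCommute.of_closure {a x y z : Γ} (hx : PhaseCommute a x) (hy : PhaseCommute a y)
    (hz : z ∈ closure {x, y}) : PhaseCommute a z := by
  have h : closure {x, y} ≤
      (centralizer {(a : Γ ⧸ center Γ)}).comap (QuotientGroup.mk' (center Γ)) := by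
    rw [closure_le]
    rintro w (rfl | rfl)
    · exact mem_centralizer_singleton_iff.2 hx.symm
    · exact mem_centralizer_singleton_iff.2 hy.symm
  exact (mem_centralizer_singleton_iff.1 (h hz)).symm

theorem conj_mem_of_closure {L : Subgroup Γ} {s : Set Γ} {A z : Γ}
    (hs : ∀ x ∈ s, A * x * A⁻¹ ∈ L) (hz : z ∈ closure s) : A * z * A⁻¹ ∈ L := by
  have h : closure s ≤ L.comap (MulAut.conj A).toMonoidHom := by
    rw [closure_le]
    exact fun x hx => hs x hx
  exact h hz

theorem commute_of_closure {s : Set Γ} {a z : Γ}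
    (hs : ∀ x ∈ s, Commute a x) (hz : z ∈ closure s) : Commute a z := by
  have h : closure s ≤ centralizer {a} := by
    rw [closure_le]
    exact fun x hx => mem_centralizer_singleton_iff.2 (hs x hx).symm
  exact (mem_centralizer_singleton_iff.1 (h hz)).symm

theorem conj_mem_center_iff {g a : Γ} : g * a * g⁻¹ ∈ center Γ ↔ a ∈ center Γ := by
  refine ⟨fun h => ?_, fun h => (inferInstance : (center Γ).Normal).conj_mem a h g⟩
  simpa [mul_assoc] using (inferInstance : (center Γ).Normal).conj_mem _ h g⁻¹

theorem commute_of_conj_eq {C C' G T z : Γ} (h : C * z * C⁻¹ = T)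
    (h' : C' * z * C'⁻¹ = G * T * G⁻¹) : Commute (C'⁻¹ * G * C) z := by
  rw [commute_iff_eq, ← mul_inv_eq_iff_eq_mul]
  calc C'⁻¹ * G * C * z * (C'⁻¹ * G * C)⁻¹ = C'⁻¹ * (G * (C * z * C⁻¹) * G⁻¹) * C' := by group
    _ = z := by rw [h, ← h']; group

theorem prime_mul_card_le_of_lt {p : ℕ} [Fact p.Prime] {H K : Subgroup Γ} [Finite K]
    (hK : IsPGroup p K) (h : H < K) : p * Nat.card H ≤ Nat.card K := by
  rw [← relIndex_bot_left K, ← relIndex_bot_left H, ← relIndex_mul_relIndex ⊥ H K bot_le h.le,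
    mul_comm]
  refine Nat.mul_le_mul_left _ ?_
  obtain ⟨n, hn⟩ := hK.index (H.subgroupOf K)
  have hr : H.relIndex K = p ^ n := hn
  rcases n with _ | n
  · rw [pow_zero, relIndex_eq_one] at hr
    exact absurd hr h.not_ge
  · rw [hr]
    exact Nat.le_of_dvd (pow_pos (Fact.out : p.Prime).pos _) (dvd_pow_self p n.succ_ne_zero)

/-- A `p`-group acting by conjugation on a nontrivial `p`-group has a fixed point other than `1`. -/
theorem exists_ne_one_forall_conj_eq {p : ℕ} [Fact p.Prime] {G : Type*} [Group G]
    (hG : IsPGroup p G) (f : G →* Γ) {L : Subgroup Γ} [Finite L] (hL : IsPGroup p L)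
    (hL1 : L ≠ ⊥) (hf : ∀ g, ∀ x ∈ L, f g * x * (f g)⁻¹ ∈ L) :
    ∃ x ∈ L, x ≠ 1 ∧ ∀ g, f g * x * (f g)⁻¹ = x := by
  let _ : MulAction G L :=
    { smul := fun g x => ⟨f g * x * (f g)⁻¹, hf g x x.2⟩
      one_smul := fun x => Subtype.ext <| show f 1 * (x : Γ) * (f 1)⁻¹ = x by simp
      mul_smul := fun g h x => Subtype.ext <|
        show f (g * h) * (x : Γ) * (f (g * h))⁻¹ = f g * (f h * x * (f h)⁻¹) * (f g)⁻¹ by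
          simp [mul_assoc] }
  have hdvd : p ∣ Nat.card L := by
    obtain ⟨n, hn⟩ := IsPGroup.iff_card.1 hL
    rcases n with _ | n
    · rw [pow_zero, card_eq_one] at hn
      exact absurd hn hL1
    · exact hn ▸ dvd_pow_self p n.succ_ne_zero
  have h1 : (1 : L) ∈ MulAction.fixedPoints G L := fun g =>
    Subtype.ext <| show f g * (1 : Γ) * (f g)⁻¹ = 1 by simp
  obtain ⟨b, hb, hne⟩ := hG.exists_fixed_point_of_prime_dvd_card_of_fixed_point L hdvd h1
  exact ⟨b, b.2, fun h => hne (Subtype.ext h.symm), fun g => congrArg Subtype.val (hb g)⟩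

namespace IsPauliLike

variable {p : ℕ} {P : Subgroup Γ}

theorem isPGroup (h : IsPauliLike p P) {H : Subgroup Γ} (hH : H ≤ P) : IsPGroup p H :=
  fun x => ⟨1, Subtype.ext <| by simpa using h.pow_eq_one x (hH x.2)⟩

theorem exists_not_commute (h : IsPauliLike p P) {x : Γ} (hx : x ∉ center Γ) :
    ∃ y ∈ P, ¬ Commute x y := by
  by_contra! hc
  exact hx (h.mem_center x hc)

variable [Fact p.Prime]

/-- Two noncommuting elements generate the whole group: a proper subgroup has order at most `p²`,
hence is commutative. -/
theorem le_closure (h : IsPauliLike p P) {x y : Γ} (hx : x ∈ P) (hy : y ∈ P)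
    (hxy : ¬ Commute x y) : P ≤ closure {x, y} := by
  have := h.finite
  have hle : closure {x, y} ≤ P := by
    rw [closure_le]
    rintro w (rfl | rfl) <;> assumption
  have hfin : Finite (closure {x, y}) := Finite.of_injective _ (inclusion_injective hle)
  have hxm : x ∈ closure {x, y} := subset_closure (by simp)
  have hym : y ∈ closure {x, y} := subset_closure (by simp)
  set H := closure {x, y}
  obtain ⟨n, hn⟩ := IsPGroup.iff_card.1 (h.isPGroup hle)
  have hcomm : ¬ IsMulCommutative H := fun hc =>
    hxy (congrArg Subtype.val (hc.is_comm.comm ⟨x, hxm⟩ ⟨y, hym⟩))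
  have hn3 : 3 ≤ n := by
    by_contra hlt
    have : n = 0 ∨ n = 1 ∨ n = 2 := by omega
    rcases this with rfl | rfl | rfl
    · rw [pow_zero, card_eq_one] at hn
      rw [hn, mem_bot] at hxm hym
      exact hxy (by rw [hxm, hym])
    · rw [pow_one] at hn
      have := isCyclic_of_prime_card hn
      exact hcomm inferInstance
    · exact hcomm (IsPGroup.isMulCommutative_of_card_eq_prime_sq hn)
  refine (eq_of_le_of_card_ge hle ?_).ge
  rw [hn]
  exact h.card_le.trans (Nat.pow_le_pow_right (Fact.out : p.Prime).pos hn3)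

/-- Commuting with a noncentral element is transitive: centralizers are commutative. -/
theorem commute_trans (h : IsPauliLike p P) {x y z : Γ} (hx : x ∈ P) (hz : z ∈ P)
    (hyc : y ∉ center Γ) (hxy : Commute x y) (hyz : Commute y z) : Commute x z := by
  by_contra hxz
  refine hyc (h.mem_center y fun w hw => commute_of_closure (s := {x, z}) ?_
    (h.le_closure hx hz hxz hw))
  rintro v (rfl | rfl)
  exacts [hxy.symm, hyz]

theorem conj_mem_of_not_commute (h : IsPauliLike p P) {A x y : Γ} (hx : x ∈ P) (hy : y ∈ P)
    (hxy : ¬ Commute x y) (hAx : A * x * A⁻¹ ∈ P) (hAy : A * y * A⁻¹ ∈ P) :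
    ∀ z ∈ P, A * z * A⁻¹ ∈ P := by
  refine fun z hz => conj_mem_of_closure (s := {x, y}) ?_ (h.le_closure hx hy hxy hz)
  rintro v (rfl | rfl) <;> assumption

/-- The centralizer in `P` of a noncentral element is generated by that element and phases. -/
theorem mem_closure_of_commute (h : IsPauliLike p P) {x y : Γ} (hx : x ∈ P)
    (hxc : x ∉ center Γ) (hy : y ∈ P) (hxy : Commute x y) :
    y ∈ closure ({x} ∪ (P ⊓ center Γ : Subgroup Γ)) := by
  have := h.finite
  obtain ⟨r, hr, hxr⟩ := h.exists_not_commute hxc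
  have hLP : P ⊓ centralizer {x} ≤ P := inf_le_left
  have hML : closure ({x} ∪ (P ⊓ center Γ : Subgroup Γ)) ≤ P ⊓ centralizer {x} := by
    rw [closure_le]
    rintro w (rfl | ⟨hw, hwc⟩)
    · exact ⟨hx, mem_centralizer_singleton_iff.2 rfl⟩
    · exact ⟨hw, mem_centralizer_singleton_iff.2 ((mem_center_iff.1 hwc x).symm)⟩
  have hfinL : Finite (P ⊓ centralizer {x} : Subgroup Γ) :=
    Finite.of_injective _ (inclusion_injective hLP)
  have hxM : x ∈ closure ({x} ∪ (P ⊓ center Γ : Subgroup Γ)) := subset_closure (by simp)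
  have hΩM : P ⊓ center Γ ≤ closure ({x} ∪ (P ⊓ center Γ : Subgroup Γ)) :=
    fun w hw => subset_closure (Or.inr hw)
  set M := closure ({x} ∪ (P ⊓ center Γ : Subgroup Γ))
  have hfinM : Finite M := Finite.of_injective _ (inclusion_injective hML)
  -- `1 < P ⊓ center Γ < M ≤ P ⊓ centralizer {x} < P`, and the three strict steps already account
  -- for the whole order `p ^ 3` of `P`, so `M = P ⊓ centralizer {x}`
  have h1 : ⊥ < P ⊓ center Γ := by
    rw [bot_lt_iff_ne_bot]
    intro hbot
    have hmem : x * r * x⁻¹ * r⁻¹ ∈ P ⊓ center Γ := by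
      refine ⟨P.mul_mem (P.mul_mem (P.mul_mem hx hr) (P.inv_mem hx)) (P.inv_mem hr), ?_⟩
      refine (QuotientGroup.eq_one_iff _).1 ?_
      have := h.phaseCommute x hx r hr
      simp only [PhaseCommute, commute_iff_eq] at this
      simp [this]
    rw [hbot, mem_bot, mul_inv_eq_one, mul_inv_eq_iff_eq_mul] at hmem
    exact hxr hmem
  have h2 : P ⊓ center Γ < M := lt_of_le_of_ne hΩM fun he => hxc (he ▸ hxM : x ∈ P ⊓ center Γ).2
  have h3 : P ⊓ centralizer {x} < P := lt_of_le_of_ne hLP fun he =>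
    hxr (mem_centralizer_singleton_iff.1 (he.ge hr).2).symm
  have hfinΩ : Finite (P ⊓ center Γ : Subgroup Γ) :=
    Finite.of_injective _ (inclusion_injective hΩM)
  have c1 := prime_mul_card_le_of_lt (h.isPGroup inf_le_left) h1
  have c2 := prime_mul_card_le_of_lt (h.isPGroup (hML.trans hLP)) h2
  have c3 := prime_mul_card_le_of_lt (h.isPGroup le_rfl) h3
  have hp : 0 < p := (Fact.out : p.Prime).pos
  have heq : M = P ⊓ centralizer {x} := by
    refine eq_of_le_of_card_ge hML (Nat.le_of_mul_le_mul_left ?_ hp)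
    rw [card_bot, mul_one] at c1
    calc p * Nat.card (P ⊓ centralizer {x} : Subgroup Γ) ≤ p ^ 3 := c3.trans h.card_le
      _ = p * (p * p) := by ring
      _ ≤ p * (p * Nat.card (P ⊓ center Γ : Subgroup Γ)) := by gcongr
      _ ≤ p * Nat.card M := by gcongr
  rw [heq]
  exact ⟨hy, mem_centralizer_singleton_iff.2 hxy.symm⟩

/-- Suppose that `A`, `B` and `A * B` all conjugate noncentral elements of `P` into `P`. If
neither `A` nor `B` normalizes `P`, then the image line of `B` is the source line of `A`. Indeed
`T = B R B⁻¹ = A⁻¹ S A` commutes up to phases with both lines; if they differ, then `T ∈ P`, and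
`T` is a second independent element that lets `A` or `B` normalize `P`. -/
theorem commute_of_sendsNoncentral_mul (h : IsPauliLike p P) {A B x y : Γ}
    (hx : x ∈ P) (hAx : A * x * A⁻¹ ∈ P) (hy : y ∈ P) (hBy : B * y * B⁻¹ ∈ P)
    (hAB : SendsNoncentral P (A * B)) (hA : ¬ ∀ z ∈ P, A * z * A⁻¹ ∈ P)
    (hB : ¬ ∀ z ∈ P, B * z * B⁻¹ ∈ P) : Commute x (B * y * B⁻¹) := by
  by_contra hxy
  obtain ⟨R, hR, hRc, hS⟩ := hAB
  have hTS : A⁻¹ * (A * B * R * (A * B)⁻¹) * A⁻¹⁻¹ = B * R * B⁻¹ := by group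
  have hTpow : (B * R * B⁻¹) ^ p = 1 := by rw [conj_pow, h.pow_eq_one R hR]; group
  have hTy : PhaseCommute (B * R * B⁻¹) (B * y * B⁻¹) := (h.phaseCommute R hR y hy).conj B
  have hTx : PhaseCommute (B * R * B⁻¹) x := by
    have := (h.phaseCommute _ hS _ hAx).conj A⁻¹
    rwa [hTS, show A⁻¹ * (A * x * A⁻¹) * A⁻¹⁻¹ = x by group] at this
  have hT : B * R * B⁻¹ ∈ P := h.mem_of_phaseCommute _ hTpow fun z hz =>
    hTx.of_closure hTy (h.le_closure hx hBy hxy hz)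
  by_cases hRy : Commute R y
  · have hTx' : ¬ Commute (B * R * B⁻¹) x := fun hc =>
      hxy (h.commute_trans hx hBy (mt conj_mem_center_iff.1 hRc) hc.symm
        ((Commute.conj_iff B).2 hRy))
    refine hA (h.conj_mem_of_not_commute hT hx hTx' ?_ hAx)
    rwa [show A * (B * R * B⁻¹) * A⁻¹ = A * B * R * (A * B)⁻¹ by group]
  · exact hB (h.conj_mem_of_not_commute hR hy hRy hT hBy)

/-- A group of elements that all conjugate some noncentral element of `P` into `P` normalizes a
common subgroup `L` of `P` with noncentral elements: `P` itself, or the common line of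
all the elements that do not normalize `P`. -/
theorem exists_invariant_subgroup (h : IsPauliLike p P) (hP : ¬ P ≤ center Γ)
    {K : Subgroup Γ} (hK : ∀ A ∈ K, SendsNoncentral P A) :
    ∃ L ≤ P, ¬ L ≤ center Γ ∧ ∀ A ∈ K, ∀ z ∈ L, A * z * A⁻¹ ∈ L := by
  by_cases hcl : ∀ A ∈ K, ∀ z ∈ P, A * z * A⁻¹ ∈ P
  · exact ⟨P, le_rfl, hP, hcl⟩
  push Not at hcl
  obtain ⟨A, hA, hAn⟩ := hcl
  replace hAn : ¬ ∀ z ∈ P, A * z * A⁻¹ ∈ P := by push Not; exact hAn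
  obtain ⟨x, hx, hxc, hAx⟩ := hK A hA
  -- any `B ∈ K` that does not normalize `P` has the same line as `A`, and preserves the
  -- centralizer of this line
  have key : ∀ B ∈ K, (¬ ∀ z ∈ P, B * z * B⁻¹ ∈ P) →
      ∀ z ∈ P ⊓ centralizer {x}, B * z * B⁻¹ ∈ P ⊓ centralizer {x} := by
    rintro B hB hBn z ⟨hz, hzx⟩
    obtain ⟨y, hy, hyc, hBy⟩ := hK B hB
    have hByc : B * y * B⁻¹ ∉ center Γ := mt conj_mem_center_iff.1 hyc
    have hxQ := h.commute_of_sendsNoncentral_mul hx hAx hy hBy (hK _ (K.mul_mem hA hB)) hAn hBn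
    have hyQ := h.commute_of_sendsNoncentral_mul hy hBy hy hBy (hK _ (K.mul_mem hB hB)) hBn hBn
    have hyx : Commute y x := h.commute_trans hy hx hByc hyQ hxQ.symm
    have hyz : Commute y z :=
      h.commute_trans hy hz hxc hyx (mem_centralizer_singleton_iff.1 hzx).symm
    refine conj_mem_of_closure ?_ (h.mem_closure_of_commute hy hyc hz hyz)
    rintro w (rfl | ⟨hw, hwc⟩)
    · exact ⟨hBy, mem_centralizer_singleton_iff.2 hxQ.symm⟩
    · have hBw : B * w * B⁻¹ = w := by rw [mem_center_iff.1 hwc B, mul_inv_cancel_right]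
      rw [hBw]
      exact ⟨hw, mem_centralizer_singleton_iff.2 (mem_center_iff.1 hwc x).symm⟩
  have := h.finite
  have hfinL : Finite (P ⊓ centralizer {x} : Subgroup Γ) :=
    Finite.of_injective _ (inclusion_injective inf_le_left)
  refine ⟨P ⊓ centralizer {x}, inf_le_left,
    fun hle => hxc (hle ⟨hx, mem_centralizer_singleton_iff.2 rfl⟩), fun B hB => ?_⟩
  by_cases hBn : ∀ z ∈ P, B * z * B⁻¹ ∈ P
  · -- `B = A⁻¹ * (A * B)`, and neither `A` nor `A * B` normalizes `P`
    have hABn : ¬ ∀ z ∈ P, A * B * z * (A * B)⁻¹ ∈ P := by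
      intro hc
      have hBN : B ∈ normalizer (P : Set Γ) :=
        mem_normalizer_fintype (S := (P : Set Γ)) hBn
      have hABN : A * B ∈ normalizer (P : Set Γ) :=
        mem_normalizer_fintype (S := (P : Set Γ)) hc
      have hAN : A ∈ normalizer (P : Set Γ) := by
        simpa using mul_mem hABN (inv_mem hBN)
      exact hAn fun z hz => (mem_normalizer_iff.1 hAN z).1 hz
    have hAN : A ∈ normalizer ((P ⊓ centralizer {x} : Subgroup Γ) : Set Γ) :=
      mem_normalizer_fintype (S := ((P ⊓ centralizer {x} : Subgroup Γ) : Set Γ)) (key A hA hAn)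
    have hABN : A * B ∈ normalizer ((P ⊓ centralizer {x} : Subgroup Γ) : Set Γ) :=
      mem_normalizer_fintype (S := ((P ⊓ centralizer {x} : Subgroup Γ) : Set Γ))
        (key _ (K.mul_mem hA hB) hABn)
    have hBN : B ∈ normalizer ((P ⊓ centralizer {x} : Subgroup Γ) : Set Γ) := by
      simpa using mul_mem (inv_mem hAN) hABN
    exact fun z hz => (mem_normalizer_iff.1 hBN z).1 hz
  · exact key B hB hBn

/-- The inductive step of the hierarchy: if all conjugates `G x G⁻¹`, `x ∈ P`, are semi-Clifford,
then so is `G`. The `p`-group `G P G⁻¹` fixes a nontrivial point `y` of the invariant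
subgroup modulo phases; then `G⁻¹ y G` commutes with `P` up to phases, so it lies in `P`. -/
theorem sendsNoncentral_of_conj (h : IsPauliLike p P) (hP : ¬ P ≤ center Γ) {G : Γ}
    (hG : ∀ x ∈ P, SendsNoncentral P (G * x * G⁻¹)) : SendsNoncentral P G := by
  have := h.finite
  obtain ⟨L, hLP, hLc, hL⟩ := h.exists_invariant_subgroup hP
    (K := P.map (MulAut.conj G).toMonoidHom) (by rintro _ ⟨x, hx, rfl⟩; exact hG x hx)
  have hfinL : Finite L := Finite.of_injective _ (inclusion_injective hLP)
  let q : Γ →* Γ ⧸ center Γ := QuotientGroup.mk' (center Γ)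
  have hfinq : Finite (L.map q) := Set.Finite.image q (Set.toFinite (L : Set Γ))
  obtain ⟨z, ⟨y, hy, rfl⟩, hy1, hfix⟩ := exists_ne_one_forall_conj_eq (L := L.map q)
    (h.isPGroup le_rfl) ((q.comp (MulAut.conj G).toMonoidHom).comp P.subtype)
    ((h.isPGroup hLP).map q) (fun hbot => hLc fun y hy => by
      have : q y ∈ L.map q := mem_map_of_mem q hy
      rw [hbot, mem_bot] at this
      exact (QuotientGroup.eq_one_iff y).1 this)
    (by
      rintro g _ ⟨y, hy, rfl⟩
      have := mem_map_of_mem q (hL _ (mem_map_of_mem _ g.2) y hy)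
      simpa using this)
  have hyc : y ∉ center Γ := fun hc => hy1 ((QuotientGroup.eq_one_iff y).2 hc)
  have hGy : G⁻¹ * y * G ∈ P := by
    refine h.mem_of_phaseCommute _ ?_ fun x hx => ?_
    · have := conj_pow (a := G⁻¹) (b := y) (i := p)
      rw [inv_inv] at this
      rw [this, h.pow_eq_one y (hLP hy)]
      group
    · have hc : PhaseCommute (G * x * G⁻¹) y := by
        have := hfix ⟨x, hx⟩
        rw [mul_inv_eq_iff_eq_mul] at this
        exact this
      have := (PhaseCommute.conj hc G⁻¹).symm
      rwa [show G⁻¹ * (G * x * G⁻¹) * G⁻¹⁻¹ = x by group, inv_inv] at this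
  refine ⟨_, hGy, ?_, ?_⟩
  · have := mt (conj_mem_center_iff (g := G⁻¹) (a := y)).1 hyc
    rwa [inv_inv] at this
  · rw [show G * (G⁻¹ * y * G) * G⁻¹ = y by group]
    exact hLP hy

end IsPauliLike

end Heisenberg

/-! ### Pauli gates in Weyl form -/

section Weyl

variable {d : ℕ} [Fact d.Prime]

theorem stdAddChar_eq_omega_pow (j : ZMod d) : ZMod.stdAddChar j = omega d ^ j.val := by
  rw [ZMod.stdAddChar_apply, ZMod.toCircle_apply, omega, ← Complex.exp_nat_mul]
  congr 1
  ring

theorem star_stdAddChar (j : ZMod d) : star (ZMod.stdAddChar j) = ZMod.stdAddChar (-j) := by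
  rw [ZMod.stdAddChar_apply, ZMod.stdAddChar_apply, AddChar.map_neg_eq_inv, Circle.coe_inv_eq_conj]
  rfl

theorem exists_stdAddChar_eq_of_pow_eq_one {c : ℂ} (hc : c ^ d = 1) :
    ∃ s : ZMod d, c = ZMod.stdAddChar s := by
  have hprim : IsPrimitiveRoot (omega d) d := Complex.isPrimitiveRoot_exp d (NeZero.ne d)
  obtain ⟨i, hi, rfl⟩ := hprim.eq_pow_of_pow_eq_one hc
  exact ⟨i, by rw [stdAddChar_eq_omega_pow, ZMod.val_natCast_of_lt hi]⟩

/-- The matrix of `ω^c Z^a X^b`, given by its entries. -/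
noncomputable def weylMatrix (c a b : ZMod d) : Matrix (ZMod d) (ZMod d) ℂ :=
  Matrix.of fun i j => if i = j + b then ZMod.stdAddChar (c + a * i) else 0

theorem weylMatrix_mul (c a b c' a' b' : ZMod d) :
    weylMatrix c a b * weylMatrix c' a' b' =
      weylMatrix (c + c' - a' * b) (a + a') (b + b') := by
  ext i j
  rw [Matrix.mul_apply, Finset.sum_eq_single (j + b')]
  · simp only [weylMatrix, Matrix.of_apply, if_true]
    by_cases h : i = j + b' + b
    · rw [if_pos h, if_pos (by rw [h]; ring), ← AddChar.map_add_eq_mul]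
      congr 1
      rw [h]
      ring
    · rw [if_neg h, if_neg (fun h' => h (by rw [h']; ring)), zero_mul]
  · intro k _ hk
    simp [weylMatrix, hk]
  · simp

theorem weylMatrix_zero : weylMatrix (0 : ZMod d) 0 0 = 1 := by
  ext i j
  simp [weylMatrix, Matrix.one_apply]

theorem star_weylMatrix (c a b : ZMod d) :
    star (weylMatrix c a b) = weylMatrix (-c - a * b) (-a) (-b) := by
  ext i j
  rw [Matrix.star_apply]
  simp only [weylMatrix, Matrix.of_apply]
  by_cases h : j = i + b
  · rw [if_pos h, if_pos (by rw [h]; ring), star_stdAddChar, h]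
    congr 1
    ring
  · rw [if_neg h, if_neg (fun h' => h (by rw [h']; ring)), star_zero]

/-- The Pauli gate `ω^c Z^a X^b`. -/
noncomputable def weyl (c a b : ZMod d) : Gate d :=
  ⟨weylMatrix c a b, by
    rw [Matrix.mem_unitaryGroup_iff, star_weylMatrix, weylMatrix_mul, ← weylMatrix_zero]
    congr 1 <;> ring⟩

theorem coe_weyl (c a b : ZMod d) :
    (weyl c a b : Matrix (ZMod d) (ZMod d) ℂ) = weylMatrix c a b := rfl

theorem weyl_mul (c a b c' a' b' : ZMod d) :
    weyl c a b * weyl c' a' b' = weyl (c + c' - a' * b) (a + a') (b + b') :=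
  Subtype.ext (weylMatrix_mul _ _ _ _ _ _)

theorem weyl_zero : weyl (0 : ZMod d) 0 0 = 1 := Subtype.ext weylMatrix_zero

theorem weyl_inv (c a b : ZMod d) : (weyl c a b)⁻¹ = weyl (-c - a * b) (-a) (-b) :=
  Subtype.ext (star_weylMatrix c a b)

theorem weyl_pow (c a b : ZMod d) (n : ℕ) :
    weyl c a b ^ n = weyl ((n : ZMod d) * c - (n.choose 2 : ZMod d) * (a * b))
      ((n : ZMod d) * a) ((n : ZMod d) * b) := by
  induction n with
  | zero => simp [weyl_zero]
  | succ n ih =>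
    rw [pow_succ, ih, weyl_mul, Nat.choose_succ_succ' n 1, Nat.choose_one_right]
    push_cast
    congr 1 <;> ring

/-- Oddness of `d` is essential: `(Z^a X^b)^d` is `ω` to the power `-ab d(d-1)/2`, which is `1` for
all `a`, `b` only because `d` divides `d(d-1)/2`. -/
theorem weyl_pow_self (hd : Odd d) (c a b : ZMod d) : weyl c a b ^ d = 1 := by
  have h2 : 2 < d := (Fact.out : d.Prime).two_le.lt_of_ne' fun h =>
    absurd (h ▸ hd) (by decide)
  have hch : ((d.choose 2 : ℕ) : ZMod d) = 0 :=
    (ZMod.natCast_eq_zero_iff _ _).2 ((Fact.out : d.Prime).dvd_choose_self two_ne_zero h2)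
  rw [weyl_pow, hch, CharP.cast_eq_zero, ← weyl_zero]
  congr 1 <;> ring

theorem weylMatrix_scalar (s : ZMod d) :
    weylMatrix s 0 0 = (ZMod.stdAddChar s : ℂ) • (1 : Matrix (ZMod d) (ZMod d) ℂ) := by
  ext i j
  simp [weylMatrix, Matrix.one_apply]

theorem mem_center_of_coe_eq_smul {g : Gate d} {c : ℂ}
    (hg : (g : Matrix (ZMod d) (ZMod d) ℂ) = c • (1 : Matrix (ZMod d) (ZMod d) ℂ)) :
    g ∈ center (Gate d) := by
  rw [mem_center_iff]
  intro h
  apply Subtype.ext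
  simp [hg]

theorem weyl_mem_center (s : ZMod d) : weyl s 0 0 ∈ center (Gate d) :=
  mem_center_of_coe_eq_smul (weylMatrix_scalar s)

theorem weyl_mul_comm (c a b c' a' b' : ZMod d) :
    weyl c a b * weyl c' a' b' =
      weyl (a * b' - a' * b) 0 0 * (weyl c' a' b' * weyl c a b) := by
  simp only [weyl_mul]
  congr 1 <;> ring

theorem pow_zmod_val_eq_of_pow_eq_one {M : Type*} [Monoid M] {x : M} (hx : x ^ d = 1) (n : ℕ) :
    x ^ (n : ZMod d).val = x ^ n := by
  rw [ZMod.val_natCast, ← pow_eq_pow_mod n hx]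

theorem weylMatrix_Z : weylMatrix (0 : ZMod d) 1 0 = matZ d := by
  ext i j
  simp only [weylMatrix, matZ, Matrix.of_apply, Matrix.diagonal_apply, add_zero, zero_add, one_mul,
    stdAddChar_eq_omega_pow]

theorem weylMatrix_X : weylMatrix (0 : ZMod d) 0 1 = matX d := by
  ext i j
  simp [weylMatrix, matX]

theorem mem_pauli_iff {g : Gate d} : g ∈ pauli d ↔ ∃ c a b : ZMod d, g = weyl c a b := by
  refine exists_congr fun c => exists_congr fun a => exists_congr fun b => ?_
  have hZ : weyl 0 1 0 ^ a.val = weyl 0 a 0 := by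
    rw [weyl_pow]
    simp
  have hX : weyl 0 0 1 ^ b.val = weyl 0 0 b := by
    rw [weyl_pow]
    simp
  have h : omega d ^ c.val • (matZ d ^ a.val * matX d ^ b.val) =
      (weyl c a b : Matrix (ZMod d) (ZMod d) ℂ) := by
    have : weyl c a b = weyl c 0 0 * (weyl 0 1 0 ^ a.val * weyl 0 0 1 ^ b.val) := by
      rw [hZ, hX, weyl_mul, weyl_mul]
      congr 1 <;> ring
    rw [this]
    simp [coe_weyl, weylMatrix_Z, weylMatrix_X, weylMatrix_scalar, stdAddChar_eq_omega_pow]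
  rw [h, Subtype.ext_iff]

theorem weyl_mem_pauli (c a b : ZMod d) : weyl c a b ∈ pauli d := mem_pauli_iff.2 ⟨c, a, b, rfl⟩

variable (d) in
/-- The Pauli gates as a subgroup of the group of gates. -/
def pauliSubgroup : Subgroup (Gate d) where
  carrier := pauli d
  mul_mem' := by
    intro x y hx hy
    obtain ⟨c, a, b, rfl⟩ := mem_pauli_iff.1 hx
    obtain ⟨c', a', b', rfl⟩ := mem_pauli_iff.1 hy
    rw [weyl_mul]
    exact weyl_mem_pauli _ _ _
  one_mem' := weyl_zero (d := d) ▸ weyl_mem_pauli _ _ _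
  inv_mem' := by
    intro x hx
    obtain ⟨c, a, b, rfl⟩ := mem_pauli_iff.1 hx
    rw [weyl_inv]
    exact weyl_mem_pauli _ _ _

theorem mem_pauliSubgroup {g : Gate d} : g ∈ pauliSubgroup d ↔ g ∈ pauli d := Iff.rfl

theorem apply_eq_zero_of_commute_Z {g : Gate d} (hZ : Commute g (weyl 0 1 0)) {i j : ZMod d}
    (hij : i ≠ j) : (g : Matrix (ZMod d) (ZMod d) ℂ) i j = 0 := by
  have h := congrFun (congrFun (congrArg Subtype.val hZ.eq) i) j
  simp only [Submonoid.coe_mul, coe_weyl, weylMatrix_Z, matZ, Matrix.mul_diagonal,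
    Matrix.diagonal_mul, ← stdAddChar_eq_omega_pow] at h
  have h' : (ZMod.stdAddChar j - ZMod.stdAddChar i : ℂ) *
      (g : Matrix (ZMod d) (ZMod d) ℂ) i j = 0 := by
    linear_combination h
  exact (mul_eq_zero.1 h').resolve_left
    (sub_ne_zero.2 fun he => hij (ZMod.injective_stdAddChar he).symm)

/-- Schur's lemma for the Pauli group: a gate that commutes with `Z` and `X` is scalar. -/
theorem coe_eq_smul_of_commute {g : Gate d} (hZ : Commute g (weyl 0 1 0))
    (hX : Commute g (weyl 0 0 1)) :
    ∃ c : ℂ, (g : Matrix (ZMod d) (ZMod d) ℂ) = c • (1 : Matrix (ZMod d) (ZMod d) ℂ) := by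
  refine ⟨(g : Matrix (ZMod d) (ZMod d) ℂ) 0 0, ?_⟩
  ext i j
  rcases eq_or_ne i j with rfl | hij
  · have hX' : Commute g (weyl 0 0 i) := by
      have := hX.pow_right i.val
      rw [weyl_pow] at this
      simpa using this
    have h := congrFun (congrFun (congrArg Subtype.val hX'.eq) i) 0
    simp only [Submonoid.coe_mul, coe_weyl, weylMatrix, Matrix.mul_apply, Matrix.of_apply] at h
    rw [Finset.sum_eq_single i, Finset.sum_eq_single 0] at h
    · simpa using h
    · intro k _ hk
      rw [if_neg (fun h' => hk (by simpa using h')), zero_mul]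
    · simp
    · intro k _ hk
      rw [if_neg (fun h' => hk (by simpa using h')), mul_zero]
    · simp
  · rw [apply_eq_zero_of_commute_Z hZ hij]
    simp [hij]

theorem exists_eq_weyl_of_mem_center {g : Gate d} (hg : g ∈ center (Gate d)) (hgd : g ^ d = 1) :
    ∃ s, g = weyl s 0 0 := by
  obtain ⟨c, hc⟩ := coe_eq_smul_of_commute (mem_center_iff.1 hg _).symm (mem_center_iff.1 hg _).symm
  have hcd : c ^ d = 1 := by
    have h := congrFun (congrFun (congrArg Subtype.val hgd) 0) 0
    simpa [hc, smul_pow] using h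
  obtain ⟨s, rfl⟩ := exists_stdAddChar_eq_of_pow_eq_one hcd
  exact ⟨s, Subtype.ext (hc.trans (weylMatrix_scalar s).symm)⟩

theorem exists_conj_eq_of_phaseCommute {T x : Gate d} (hx : x ^ d = 1) (h : PhaseCommute T x) :
    ∃ s, T * x = weyl s 0 0 * (x * T) := by
  have hc : T * x * T⁻¹ * x⁻¹ ∈ center (Gate d) := by
    refine (QuotientGroup.eq_one_iff _).1 ?_
    simp only [PhaseCommute, commute_iff_eq] at h
    simp [h]
  obtain ⟨s, hs⟩ := exists_eq_weyl_of_mem_center hc (by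
    have := (show Commute (T * x * T⁻¹ * x⁻¹) x from (mem_center_iff.1 hc x).symm).mul_pow d
    rw [inv_mul_cancel_right, conj_pow, hx, mul_one, mul_inv_cancel, mul_one] at this
    exact this.symm)
  refine ⟨s, ?_⟩
  rw [← hs]
  group

theorem commute_weyl_inv_mul {T g : Gate d} {s c a b c' a' b' : ZMod d} (hg : g = weyl c a b)
    (hT : T * g = weyl s 0 0 * (g * T)) (hs : s = a' * b - a * b') :
    Commute ((weyl c' a' b')⁻¹ * T) g := by
  have hW := weyl_mul_comm c' a' b' c a b
  rw [← hg, ← hs] at hW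
  rw [commute_iff_eq, mul_assoc, hT, inv_mul_eq_iff_eq_mul, ← mul_assoc, ← mul_assoc, ← mul_assoc,
    hW]
  group

theorem isPauliLike (hd : Odd d) : IsPauliLike d (pauliSubgroup d) where
  finite := by
    refine Set.Finite.subset (Set.finite_range fun t : ZMod d × ZMod d × ZMod d =>
      weyl t.1 t.2.1 t.2.2) ?_
    intro g hg
    obtain ⟨c, a, b, rfl⟩ := mem_pauli_iff.1 hg
    exact ⟨(c, a, b), rfl⟩
  card_le := by
    have h := Nat.card_le_card_of_surjective
      (fun t : ZMod d × ZMod d × ZMod d =>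
        (⟨weyl t.1 t.2.1 t.2.2, weyl_mem_pauli _ _ _⟩ : pauliSubgroup d))
      (by
        rintro ⟨g, hg⟩
        obtain ⟨c, a, b, rfl⟩ := mem_pauli_iff.1 hg
        exact ⟨(c, a, b), rfl⟩)
    refine h.trans_eq ?_
    simp only [Nat.card_prod, Nat.card_zmod]
    ring
  pow_eq_one := by
    intro x hx
    obtain ⟨c, a, b, rfl⟩ := mem_pauli_iff.1 hx
    exact weyl_pow_self hd c a b
  phaseCommute := by
    intro x hx y hy
    obtain ⟨c, a, b, rfl⟩ := mem_pauli_iff.1 hx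
    obtain ⟨c', a', b', rfl⟩ := mem_pauli_iff.1 hy
    rw [PhaseCommute, commute_iff_eq, ← QuotientGroup.mk_mul, weyl_mul_comm, QuotientGroup.mk_mul,
      (QuotientGroup.eq_one_iff _).2 (weyl_mem_center _), one_mul, QuotientGroup.mk_mul]
  mem_center := by
    intro g hg
    obtain ⟨c, hc⟩ := coe_eq_smul_of_commute (hg _ (weyl_mem_pauli 0 1 0))
      (hg _ (weyl_mem_pauli 0 0 1))
    exact mem_center_of_coe_eq_smul hc
  mem_of_phaseCommute := by
    intro T hT h
    obtain ⟨s, hs⟩ := exists_conj_eq_of_phaseCommute (weyl_pow_self hd 0 1 0)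
      (h _ (weyl_mem_pauli 0 1 0))
    obtain ⟨t, ht⟩ := exists_conj_eq_of_phaseCommute (weyl_pow_self hd 0 0 1)
      (h _ (weyl_mem_pauli 0 0 1))
    -- `Z^t X^{-s}` acts by conjugation on `Z` and `X` as `T` does
    obtain ⟨c, hc⟩ := coe_eq_smul_of_commute
      (commute_weyl_inv_mul (c' := 0) (a' := t) (b' := -s) rfl hs (by ring))
      (commute_weyl_inv_mul (c' := 0) (a' := t) (b' := -s) rfl ht (by ring))
    have hz := mem_center_of_coe_eq_smul hc
    obtain ⟨r, hr⟩ := exists_eq_weyl_of_mem_center hz (by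
      have := (show Commute (weyl 0 t (-s)) ((weyl 0 t (-s))⁻¹ * T) from
        mem_center_iff.1 hz _).mul_pow d
      rwa [mul_inv_cancel_left, hT, weyl_pow_self hd, one_mul, eq_comm] at this)
    rw [inv_mul_eq_iff_eq_mul] at hr
    rw [hr, mem_pauliSubgroup, weyl_mul]
    exact weyl_mem_pauli _ _ _

theorem not_commute_Z_X : ¬ Commute (weyl (0 : ZMod d) 1 0) (weyl 0 0 1) := by
  intro h
  rw [commute_iff_eq, weyl_mul_comm, mul_eq_right] at h
  have h' := congrFun (congrFun (congrArg Subtype.val h) 0) 0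
  rw [coe_weyl, weylMatrix_scalar] at h'
  have h1 : (ZMod.stdAddChar (1 : ZMod d) : ℂ) = ZMod.stdAddChar (0 : ZMod d) := by
    simpa using h'
  exact one_ne_zero (ZMod.injective_stdAddChar h1)

theorem weyl_Z_not_mem_center : weyl (0 : ZMod d) 1 0 ∉ center (Gate d) := fun h =>
  not_commute_Z_X (mem_center_iff.1 h _).symm

end Weyl

/-! ### Clifford gates and the hierarchy -/

section Hierarchy

variable {d : ℕ} [Fact d.Prime]

theorem star_mulVec_dotProduct_mulVec (U : Gate d) (v w : ZMod d → ℂ) :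
    star (U.1.mulVec v) ⬝ᵥ U.1.mulVec w = star v ⬝ᵥ w := by
  rw [Matrix.star_mulVec, ← Matrix.dotProduct_mulVec, Matrix.mulVec_mulVec,
    ← Matrix.star_eq_conjTranspose, Matrix.UnitaryGroup.star_mul_self, Matrix.one_mulVec]

/-- A unitary of order dividing `d`, with a partner `B` that multiplies its eigenvalues by `ω`,
has a unit eigenvector of eigenvalue `1`. -/
theorem exists_unit_fixed_vector {A B : Gate d} (hA : A ^ d = 1)
    (hAB : ∀ n : ℕ, A * B ^ n = weyl n 0 0 * (B ^ n * A)) :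
    ∃ v : ZMod d → ℂ, A.1.mulVec v = v ∧ star v ⬝ᵥ v = 1 := by
  obtain ⟨c, hc⟩ := Module.End.exists_eigenvalue (Matrix.toLin' A.1)
  obtain ⟨u, hu⟩ := hc.exists_hasEigenvector
  have hAu : A.1.mulVec u = c • u := by simpa using hu.apply_eq_smul
  have hpow : ∀ n : ℕ, (A ^ n).1.mulVec u = c ^ n • u := by
    intro n
    induction n with
    | zero => simp
    | succ n ih =>
      rw [pow_succ, Submonoid.coe_mul, ← Matrix.mulVec_mulVec, hAu, Matrix.mulVec_smul, ih,
        smul_smul, pow_succ']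
  have hcd : c ^ d = 1 := by
    have h := hpow d
    rw [hA, OneMemClass.coe_one, Matrix.one_mulVec] at h
    have h' : (c ^ d - 1) • u = 0 := by rw [sub_smul, one_smul, ← h, sub_self]
    exact sub_eq_zero.1 ((smul_eq_zero.1 h').resolve_right hu.2)
  obtain ⟨s, rfl⟩ := exists_stdAddChar_eq_of_pow_eq_one hcd
  -- `B ^ n` shifts the eigenvalue `ω ^ s` to `ω ^ (n + s)`
  set w := (B ^ (-s).val).1.mulVec u with hw
  have hAw : A.1.mulVec w = w := by
    rw [hw, Matrix.mulVec_mulVec, ← Submonoid.coe_mul, hAB, Submonoid.coe_mul, Submonoid.coe_mul,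
      coe_weyl, weylMatrix_scalar, smul_mul_assoc, one_mul, Matrix.smul_mulVec,
      ← Matrix.mulVec_mulVec, hAu, Matrix.mulVec_smul, smul_smul, ← AddChar.map_add_eq_mul,
      ZMod.natCast_zmod_val, neg_add_cancel, AddChar.map_zero_eq_one, one_smul]
  have hw0 : star w ⬝ᵥ w = ((∑ i, ‖u i‖ ^ 2 : ℝ) : ℂ) := by
    rw [hw, star_mulVec_dotProduct_mulVec, dotProduct]
    push_cast
    exact Finset.sum_congr rfl fun i _ => Complex.conj_mul' (u i)
  have hr : 0 < ∑ i, ‖u i‖ ^ 2 := by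
    obtain ⟨i, hi⟩ := Function.ne_iff.1 hu.2
    exact Finset.sum_pos' (fun _ _ => by positivity) ⟨i, Finset.mem_univ i, by
      have := norm_pos_iff.2 hi
      positivity⟩
  set r := ∑ i, ‖u i‖ ^ 2
  refine ⟨((√r)⁻¹ : ℂ) • w, by rw [Matrix.mulVec_smul, hAw], ?_⟩
  rw [star_smul, smul_dotProduct, dotProduct_smul, hw0, smul_smul, smul_eq_mul, star_inv₀,
    Complex.star_def, Complex.conj_ofReal, ← mul_inv, ← Complex.ofReal_mul,
    Real.mul_self_sqrt hr.le, ← Complex.ofReal_inv, ← Complex.ofReal_mul, inv_mul_cancel₀ hr.ne',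
    Complex.ofReal_one]

/-- The Stone–von Neumann theorem for `ℤ/d`: a pair of unitaries satisfying the relations of `Z`
and `X` is unitarily equivalent to `Z`, `X`. The columns of the intertwiner are `B ^ j v`, for a
unit vector `v` fixed by `A`. -/
theorem exists_conj_Z_X {A B : Gate d} (hA : A ^ d = 1) (hB : B ^ d = 1)
    (hAB : ∀ n : ℕ, A * B ^ n = weyl n 0 0 * (B ^ n * A)) :
    ∃ U : Gate d, U * weyl 0 1 0 * U⁻¹ = A ∧ U * weyl 0 0 1 * U⁻¹ = B := by
  obtain ⟨v, hv, hv1⟩ := exists_unit_fixed_vector hA hAB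
  let e : ZMod d → ZMod d → ℂ := fun j => (B ^ j.val).1.mulVec v
  have hAe : ∀ j, A.1.mulVec (e j) = (ZMod.stdAddChar j : ℂ) • e j := by
    intro j
    simp only [e]
    rw [Matrix.mulVec_mulVec, ← Submonoid.coe_mul, hAB, Submonoid.coe_mul, Submonoid.coe_mul,
      coe_weyl, weylMatrix_scalar, smul_mul_assoc, one_mul, Matrix.smul_mulVec,
      ← Matrix.mulVec_mulVec, hv, ZMod.natCast_zmod_val]
  have hBe : ∀ j, B.1.mulVec (e j) = e (j + 1) := by
    intro j
    simp only [e]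
    rw [Matrix.mulVec_mulVec, ← Submonoid.coe_mul, ← pow_succ', ← pow_zmod_val_eq_of_pow_eq_one hB]
    push_cast
    rw [ZMod.natCast_zmod_val]
  have horth : ∀ i j, star (e i) ⬝ᵥ e j = if i = j then 1 else 0 := by
    intro i j
    split_ifs with hij
    · subst hij
      simp only [e]
      rw [star_mulVec_dotProduct_mulVec, hv1]
    · have h := star_mulVec_dotProduct_mulVec A (e i) (e j)
      rw [hAe, hAe, star_smul, smul_dotProduct, dotProduct_smul, smul_smul, star_stdAddChar,
        ← AddChar.map_add_eq_mul, smul_eq_mul] at h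
      have h' : ((ZMod.stdAddChar (-i + j) : ℂ) - 1) * (star (e i) ⬝ᵥ e j) = 0 := by
        linear_combination h
      refine (mul_eq_zero.1 h').resolve_left fun h1 => hij ?_
      rw [sub_eq_zero, ← AddChar.map_zero_eq_one (ZMod.stdAddChar (N := d))] at h1
      exact neg_add_eq_zero.1 (ZMod.injective_stdAddChar h1)
  let M : Matrix (ZMod d) (ZMod d) ℂ := Matrix.of fun i j => e j i
  have hM : M ∈ Matrix.unitaryGroup (ZMod d) ℂ := by
    rw [Matrix.mem_unitaryGroup_iff']
    ext i j
    rw [Matrix.one_apply, ← horth i j]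
    rfl
  refine ⟨⟨M, hM⟩, ?_, ?_⟩
  · rw [mul_inv_eq_iff_eq_mul]
    apply Subtype.ext
    ext i j
    have h := congrFun (hAe j) i
    rw [Submonoid.coe_mul, Submonoid.coe_mul, coe_weyl, weylMatrix_Z, matZ, Matrix.mul_diagonal,
      ← stdAddChar_eq_omega_pow]
    refine Eq.trans ?_ h.symm
    simp [M, mul_comm]
  · rw [mul_inv_eq_iff_eq_mul]
    apply Subtype.ext
    ext i j
    have h := congrFun (hBe j) i
    rw [Submonoid.coe_mul, Submonoid.coe_mul, coe_weyl, weylMatrix_X]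
    refine Eq.trans ?_ h.symm
    simp [M, matX, Matrix.mul_apply]

theorem mem_clifford_iff {C : Gate d} :
    C ∈ clifford d ↔ ∀ P ∈ pauliSubgroup d, C * P * C⁻¹ ∈ pauliSubgroup d := Iff.rfl

theorem mem_clifford_iff_mem_normalizer (hd : Odd d) {C : Gate d} :
    C ∈ clifford d ↔ C ∈ normalizer (pauliSubgroup d : Set (Gate d)) := by
  have : Finite (pauliSubgroup d : Set (Gate d)) := (isPauliLike hd).finite
  exact ⟨fun h => mem_normalizer_fintype h, fun h P hP => (mem_normalizer_iff.1 h P).1 hP⟩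

/-- The Clifford gates act transitively on the noncentral Pauli gates. -/
theorem exists_clifford_conj_Z_eq (hd : Odd d) {A : Gate d} (hA : A ∈ pauliSubgroup d)
    (hAc : A ∉ center (Gate d)) : ∃ C ∈ clifford d, C * weyl 0 1 0 * C⁻¹ = A := by
  obtain ⟨c, a, b, rfl⟩ := mem_pauli_iff.1 hA
  obtain ⟨a', b', hab⟩ : ∃ a' b' : ZMod d, a * b' - a' * b = 1 := by
    by_cases ha : a = 0
    · have hb : b ≠ 0 := by
        rintro rfl
        exact hAc (ha ▸ weyl_mem_center c)
      exact ⟨-b⁻¹, 0, by simp [hb]⟩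
    · exact ⟨0, a⁻¹, by simp [ha]⟩
  obtain ⟨U, hUZ, hUX⟩ := exists_conj_Z_X (A := weyl c a b) (B := weyl 0 a' b')
    (weyl_pow_self hd _ _ _) (weyl_pow_self hd _ _ _) (fun n => by
      rw [weyl_pow, weyl_mul_comm]
      congr 2
      linear_combination (n : ZMod d) * hab)
  refine ⟨U, mem_clifford_iff.2 ?_, hUZ⟩
  exact (isPauliLike hd).conj_mem_of_not_commute (weyl_mem_pauli _ _ _) (weyl_mem_pauli _ _ _)
    not_commute_Z_X (hUZ ▸ hA) (hUX ▸ weyl_mem_pauli 0 a' b')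

theorem clifford_mul_level_mul (hd : Odd d) (k : ℕ) {C C' G : Gate d} (hC : C ∈ clifford d)
    (hC' : C' ∈ clifford d) (hG : G ∈ level d (k + 2)) : C * G * C' ∈ level d (k + 2) := by
  induction k generalizing C C' G with
  | zero =>
    intro P hP
    have h := hC _ (hG _ (hC' P hP))
    simp only [Unitary.star_eq_inv] at h ⊢
    rwa [show C * G * C' * P * (C * G * C')⁻¹ = C * (G * (C' * P * C'⁻¹) * G⁻¹) * C⁻¹ by group]
  | succ k ih =>
    intro P hP
    have hCi : C⁻¹ ∈ clifford d := by
      rw [mem_clifford_iff_mem_normalizer hd] at hC ⊢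
      exact inv_mem hC
    have h := ih hC hCi (hG _ (hC' P hP))
    simp only [Unitary.star_eq_inv] at h ⊢
    rwa [show C * G * C' * P * (C * G * C')⁻¹ = C * (G * (C' * P * C'⁻¹) * G⁻¹) * C⁻¹ by group]

theorem sendsNoncentral_of_mem_level (hd : Odd d) (k : ℕ) {G : Gate d} (hG : G ∈ level d (k + 1)) :
    SendsNoncentral (pauliSubgroup d) G := by
  induction k generalizing G with
  | zero =>
    have hG' : G ∈ pauliSubgroup d := hG
    exact ⟨weyl 0 1 0, weyl_mem_pauli _ _ _, weyl_Z_not_mem_center,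
      mul_mem (mul_mem hG' (weyl_mem_pauli _ _ _)) (inv_mem hG')⟩
  | succ k ih =>
    exact (isPauliLike hd).sendsNoncentral_of_conj
      (fun h => weyl_Z_not_mem_center (h (weyl_mem_pauli 0 1 0))) fun P hP => ih (hG P hP)

theorem mem_clifford_of_mem_center {g : Gate d} (hg : g ∈ center (Gate d)) : g ∈ clifford d := by
  rw [mem_clifford_iff]
  intro P hP
  rwa [← mem_center_iff.1 hg P, mul_inv_cancel_right]

/-- A gate commuting with `Z` is, up to a phase, a diagonal gate fixing `|0⟩`. -/
theorem exists_center_mul_eq_of_commute_Z {g : Gate d} (hZ : Commute g (weyl 0 1 0)) :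
    ∃ z ∈ center (Gate d), ((z * g : Gate d) : Matrix (ZMod d) (ZMod d) ℂ).IsDiag ∧
      ((z * g : Gate d) : Matrix (ZMod d) (ZMod d) ℂ).mulVec (ket 0) = ket 0 := by
  have hoff : ∀ i j, i ≠ j → (g : Matrix (ZMod d) (ZMod d) ℂ) i j = 0 :=
    fun i j hij => apply_eq_zero_of_commute_Z hZ hij
  have h00 : star ((g : Matrix (ZMod d) (ZMod d) ℂ) 0 0) * (g : Matrix (ZMod d) (ZMod d) ℂ) 0 0
      = 1 := by
    have h := congrFun (congrFun (Matrix.UnitaryGroup.star_mul_self g) 0) 0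
    rw [Matrix.mul_apply, Finset.sum_eq_single 0] at h
    · simpa [Matrix.star_apply] using h
    · intro k _ hk
      rw [hoff k 0 hk, mul_zero]
    · simp
  set c := (g : Matrix (ZMod d) (ZMod d) ℂ) 0 0
  let z : Gate d := ⟨star c • 1, by
    rw [Matrix.mem_unitaryGroup_iff, star_smul, star_star, star_one, smul_mul_smul_comm, h00,
      one_smul, one_mul]⟩
  have hzg : ((z * g : Gate d) : Matrix (ZMod d) (ZMod d) ℂ) = star c • g.1 := by
    rw [Submonoid.coe_mul, show (z : Matrix (ZMod d) (ZMod d) ℂ) = star c • 1 from rfl,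
      smul_mul_assoc, one_mul]
  refine ⟨z, mem_center_of_coe_eq_smul (c := star c) rfl, ?_, ?_⟩
  · intro i j hij
    rw [hzg, Matrix.smul_apply, hoff i j hij, smul_zero]
  · ext i
    rw [hzg, ket, Matrix.mulVec_single_one, Matrix.col_apply, Matrix.smul_apply]
    by_cases hi : i = 0
    · subst hi
      simpa using h00
    · rw [hoff i 0 hi, smul_zero, Pi.single_eq_of_ne hi]

theorem one_mem_diagLevel_one : (1 : Gate d) ∈ diagLevel d 1 := by
  refine ⟨(pauliSubgroup d).one_mem, ?_, ?_⟩
  · simp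
  · simp

theorem pauli_subset_clifford {C : Gate d} (hC : C ∈ pauli d) : C ∈ clifford d := fun _ hP =>
  (pauliSubgroup d).mul_mem ((pauliSubgroup d).mul_mem hC hP) ((pauliSubgroup d).inv_mem hC)

theorem mem_semiClifford_of_sendsNoncentral (hd : Odd d) (k : ℕ) {G : Gate d}
    (hG : G ∈ level d (k + 2)) (h : SendsNoncentral (pauliSubgroup d) G) :
    G ∈ semiClifford d (k + 2) := by
  obtain ⟨T, hT, hTc, hGT⟩ := h
  obtain ⟨C, hC, hCZ⟩ := exists_clifford_conj_Z_eq hd hT hTc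
  obtain ⟨C', hC', hCZ'⟩ := exists_clifford_conj_Z_eq hd hGT (mt conj_mem_center_iff.1 hTc)
  have hcomm : Commute (C'⁻¹ * G * C) (weyl 0 1 0) :=
    commute_of_conj_eq hCZ hCZ'
  obtain ⟨z, hz, hdiag, hket⟩ := exists_center_mul_eq_of_commute_Z hcomm
  have hmul {A B : Gate d} (hA : A ∈ clifford d) (hB : B ∈ clifford d) : A * B ∈ clifford d := by
    rw [mem_clifford_iff_mem_normalizer hd] at *
    exact mul_mem hA hB
  have hinv {A : Gate d} (hA : A ∈ clifford d) : A⁻¹ ∈ clifford d := by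
    rw [mem_clifford_iff_mem_normalizer hd] at *
    exact inv_mem hA
  refine ⟨hG, C' * z⁻¹, hmul hC' (hinv (mem_clifford_of_mem_center hz)), z * (C'⁻¹ * G * C),
    ⟨?_, hdiag, hket⟩, C⁻¹, hinv hC, by group⟩
  have := clifford_mul_level_mul hd k (hmul (mem_clifford_of_mem_center hz) (hinv hC')) hC hG
  rwa [show z * (C'⁻¹ * G * C) = z * C'⁻¹ * G * C by group]

end Hierarchy

end Qudit

theorem mainTheorem1 (d : ℕ) [Fact d.Prime] (hd : Odd d) (k : ℕ) (hk : 1 ≤ k)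
    (G : Qudit.Gate d) (hG : G ∈ Qudit.level d k) : G ∈ Qudit.semiClifford d k := by
  obtain _ | _ | k := k
  · omega
  · exact ⟨hG, G, Qudit.pauli_subset_clifford hG, 1, Qudit.one_mem_diagLevel_one, 1,
      Qudit.mem_clifford_of_mem_center (Subgroup.one_mem _), by rw [mul_one, mul_one]⟩
  · exact Qudit.mem_semiClifford_of_sendsNoncentral hd k hG
      (Qudit.sendsNoncentral_of_mem_level hd (k + 1) hG)
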